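/- Let $Q_0=1$, $Q_1=z$ and, for $n\ge 1$, let the Yablonskii--Vorob'ev polynomial $Q_{n+1}$ be determined by $$Q_{n+1}Q_{n-1}=zQ_n^2-4\bigl(Q_nQ_n''-(Q_n')^2\bigr);$$ the right-hand side is divisible by $Q_{n-1}$ for every $n\ge 1$, so the $Q_n$ are well-defined polynomials with real coefficients. For $n\in\mathbb{N}=\{0,1,2,\dots\}$ let $Z_n$ be the set of real roots of $Q_n$, and let $[x]$ denote the integer part of $x$. Then, for every $n\in\mathbb{N}$, the number of negative real roots of $Q_n$ is $$|Z_n\cap(-\infty,0)|=\left[\frac{n+1}{3}\right],$$ and the number of positive real roots of $Q_n$ is $$|Z_n\cap(0,\infty)|=\begin{cases}\left[\dfrac{n}{6}\right]&\text{if } n \text{ is even},\\[1ex]\left[\dfrac{n+3}{6}\right]&\text{if } n \text{ is odd}.\end{cases}$$ -/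

import Mathlib

open Polynomial

/-- The right-hand side `z f² - 4 (f f'' - (f')²)` of the differential-difference equation
defining the Yablonskii-Vorob'ev polynomials. -/
noncomputable def yablonskiiVorobevRHS (f : ℝ[X]) : ℝ[X] :=
  X * f ^ 2 - 4 * (f * derivative (derivative f) - derivative f ^ 2)

/-- The Yablonskii-Vorob'ev polynomials: `Q₀ = 1`, `Q₁ = z` and
`Q_{n+2} Q_n = z Q_{n+1}² - 4 (Q_{n+1} Q_{n+1}'' - (Q_{n+1}')²)`.
The recursion is solved for `Q_{n+2}` by Euclidean division in `ℝ[X]`; that this division leaves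
no remainder is part of what the theorem about them asserts. -/
noncomputable def yablonskiiVorobev : ℕ → ℝ[X]
  | 0 => 1
  | 1 => X
  | n + 2 => yablonskiiVorobevRHS (yablonskiiVorobev (n + 1)) / yablonskiiVorobev n

/-- The set `Z_n` of real roots of the `n`-th Yablonskii-Vorob'ev polynomial. -/
def yablonskiiVorobevRealRoots (n : ℕ) : Set ℝ :=
  {x : ℝ | (yablonskiiVorobev n).eval x = 0}

/-!
Write `b = Qₙ` and `c = Qₙ₊₁`. The pair satisfies a bilinear system of order two and three, with
`D` the Hirota derivative: `D² c·b = 0` and `D³ c·b = X (D c·b) - (n + 1) c b`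
(`IsHirotaPair`). From this system and the coprimality of `b` and `c` follow, by identities between
differential polynomials, the separability of `b` and `c`, the exact divisibility of
`X c² - 4 (c c'' - c'²)` by `b`, the Wronskian identity `d' b - d b' = (2n + 3) c²` for the quotient
`d = Qₙ₊₂`, and the same system for the pair `(c, d)`. Induction thus gives the recursion for all `n`.

By the Wronskian identity `Qₙ₊₂ / Qₙ` increases between its poles, so that the real roots of `Qₙ`
and `Qₙ₊₂` interlace. The product `Qₙ₊₂ Qₙ` has odd degree and positive leading coefficient, so
the quotient is negative near `-∞` and positive near `∞`. Whether the number of roots in a half-line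
grows by one from `Qₙ` to `Qₙ₊₂` therefore depends only on the quotient at the origin
(`PosWronskian.card_neg_pos`). There, the symmetry of the recursion under rotation by a third of a
turn makes `Qₙ` vanish for `n ≡ 1` modulo `3`, simply by separability, and coprimality of neighbours
excludes a zero for other `n`; for `n ≡ 0` the recursion gives `Qₙ₊₂(0) Qₙ(0) = 4 Qₙ₊₁'(0)² > 0`.
The counts follow by induction in steps of two (`card_step`).
-/

/-! ### The bilinear system and its Bäcklund transformation -/

/-- The bilinear system satisfied by consecutive Yablonskii-Vorob'ev polynomials `b = Qₙ`,
`c = Qₙ₊₁` with `κ = n + 1`, together with their coprimality. In terms of the Hirota derivative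
`D`, the two equations read `D² c·b = 0` and `D³ c·b = X (D c·b) - κ c b`; they say that
`w = c' / c - b' / b` solves the second Painlevé equation `w'' = 2 w³ + X w - κ`. -/
structure IsHirotaPair (κ : ℝ) (b c : ℝ[X]) : Prop where
  ne_zero_left : b ≠ 0
  ne_zero_right : c ≠ 0
  isCoprime : IsCoprime b c
  bilinear_two : derivative (derivative c) * b - 2 * derivative c * derivative b
    + c * derivative (derivative b) = 0
  bilinear_three : derivative (derivative (derivative c)) * b
      - 3 * derivative (derivative c) * derivative b
      + 3 * derivative c * derivative (derivative b)
      - c * derivative (derivative (derivative b)) =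
    X * (derivative c * b - c * derivative b) - C κ * c * b

theorem derivative_pow_succ_mul (p v : ℝ[X]) (k : ℕ) :
    derivative (p ^ (k + 1) * v) =
      p ^ k * (C ((k : ℝ) + 1) * derivative p * v + p * derivative v) := by
  rw [derivative_mul, derivative_pow_succ]
  ring

/-- Viewed as a linear second order equation for `c`, `D² c·b = 0` has leading coefficient `b`, which
does not vanish at the roots of `c`; a multiple root of `c` would make `c` vanish identically. Here
this uniqueness argument is run `p`-adically, for an irreducible `p` with `p² ∣ c`. -/
theorem separable_of_bilinear_two {b c : ℝ[X]} (hc : c ≠ 0) (hcop : IsCoprime b c)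
    (h : derivative (derivative c) * b - 2 * derivative c * derivative b
      + c * derivative (derivative b) = 0) : c.Separable := by
  rw [PerfectField.separable_iff_squarefree, squarefree_iff_irreducible_sq_not_dvd_of_ne_zero hc]
  intro p hp hpp
  have hpb : ¬ p ∣ b := fun hpb =>
    hp.not_isUnit (hcop.isUnit_of_dvd' hpb ((dvd_mul_right p p).trans hpp))
  have hpd : ¬ p ∣ derivative p := fun hd =>
    hp.not_isUnit (IsCoprime.isUnit_of_dvd' hp.separable dvd_rfl hd)
  have key : ∀ k : ℕ, p ^ (k + 2) ∣ c := by
    intro k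
    induction k with
    | zero => simpa [pow_two] using hpp
    | succ k ih =>
      obtain ⟨u, rfl⟩ := ih
      -- The coefficient of the lowest power `p ^ k` in the equation.
      have hpu : p ∣ C ((k : ℝ) + 2) * C ((k : ℝ) + 1) * derivative p ^ 2 * u * b := by
        rw [derivative_pow_succ_mul, derivative_pow_succ_mul] at h
        set v := C (((k + 1 : ℕ) : ℝ) + 1) * derivative p * u + p * derivative u with hv
        have h2 : p ^ k * ((C ((k : ℝ) + 1) * derivative p * v + p * derivative v) * b
            - 2 * p * v * derivative b + p ^ 2 * u * derivative (derivative b)) = 0 := by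
          rw [← h]
          ring
        have h3 := (mul_eq_zero.mp h2).resolve_left (pow_ne_zero _ hp.ne_zero)
        refine ⟨-(C ((k : ℝ) + 1) * derivative p * derivative u * b + derivative v * b
          - 2 * v * derivative b + p * u * derivative (derivative b)), ?_⟩
        have hk : (C (((k + 1 : ℕ) : ℝ) + 1) : ℝ[X]) = C ((k : ℝ) + 2) := by
          push_cast
          congr 1
          ring
        rw [hk] at hv
        linear_combination h3 - C ((k : ℝ) + 1) * derivative p * b * hv
      have hC : ∀ r : ℝ, 0 < r → ¬ p ∣ C r := fun r hr hd =>
        hp.not_isUnit (isUnit_of_dvd_unit hd (isUnit_C.2 hr.ne'.isUnit))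
      have hu : p ∣ u := by
        have hp' := hp.prime
        rcases hp'.dvd_or_dvd hpu with h | h
        · rcases hp'.dvd_or_dvd h with h | h
          · rcases hp'.dvd_or_dvd h with h | h
            · rcases hp'.dvd_or_dvd h with h | h
              · exact absurd h (hC _ (by positivity))
              · exact absurd h (hC _ (by positivity))
            · exact absurd (hp'.dvd_of_dvd_pow h) hpd
          · exact h
        · exact absurd h hpb
      exact mul_dvd_mul_left (p ^ (k + 2)) hu
  have hfin : FiniteMultiplicity p c := FiniteMultiplicity.of_prime_left hp.prime hc
  obtain ⟨n, hn⟩ := hfin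
  exact hn ((pow_dvd_pow p (by omega)).trans (key n))

theorem leading_yablonskiiVorobevRHS {c : ℝ[X]} (hc : c ≠ 0) :
    (yablonskiiVorobevRHS c).natDegree = 2 * c.natDegree + 1 ∧
      (yablonskiiVorobevRHS c).leadingCoeff = c.leadingCoeff ^ 2 := by
  have h1 : (X * c ^ 2).natDegree = 2 * c.natDegree + 1 := by
    rw [natDegree_X_mul (pow_ne_zero 2 hc), natDegree_pow]
  have hd : (derivative c).natDegree ≤ c.natDegree :=
    (natDegree_derivative_le c).trans (Nat.sub_le _ _)
  have hdd : (derivative (derivative c)).natDegree ≤ c.natDegree :=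
    ((natDegree_derivative_le _).trans (Nat.sub_le _ _)).trans hd
  have h2 : (4 * (c * derivative (derivative c) - derivative c ^ 2)).natDegree <
      (X * c ^ 2).natDegree := by
    rw [h1, Nat.lt_succ_iff]
    compute_degree
    omega
  constructor
  · rw [yablonskiiVorobevRHS, natDegree_sub_eq_left_of_natDegree_lt h2, h1]
  · rw [yablonskiiVorobevRHS, leadingCoeff_sub_of_degree_lt (degree_lt_degree h2),
      leadingCoeff_mul, leadingCoeff_X, one_mul, leadingCoeff_pow]

theorem yablonskiiVorobevRHS_ne_zero {c : ℝ[X]} (hc : c ≠ 0) : yablonskiiVorobevRHS c ≠ 0 := by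
  intro h
  have := (leading_yablonskiiVorobevRHS hc).1
  simp [h] at this

theorem IsHirotaPair.separable_right {κ : ℝ} {b c : ℝ[X]} (h : IsHirotaPair κ b c) : c.Separable :=
  separable_of_bilinear_two h.ne_zero_right h.isCoprime h.bilinear_two

theorem IsHirotaPair.separable_left {κ : ℝ} {b c : ℝ[X]} (h : IsHirotaPair κ b c) : b.Separable :=
  separable_of_bilinear_two h.ne_zero_left h.isCoprime.symm
    (by linear_combination h.bilinear_two)

theorem derivative_bilinear_two {b c : ℝ[X]}
    (h : derivative (derivative c) * b - 2 * derivative c * derivative b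
      + c * derivative (derivative b) = 0) :
    derivative (derivative (derivative c)) * b - derivative (derivative c) * derivative b
      - derivative c * derivative (derivative b)
      + c * derivative (derivative (derivative b)) = 0 := by
  have h' := congrArg derivative h
  simp only [derivative_add, derivative_sub, derivative_mul, derivative_ofNat,
    derivative_zero] at h'
  linear_combination h'

/-- Modulo `b`, the equation `D² c·b = 0` and its derivative express `c' b'` and `c'' b'` through `c`
and the derivatives of `b`; the third order equation then says that `(b')²` times the right-hand
side of the recursion vanishes, and `b'` is invertible modulo `b`. -/
theorem IsHirotaPair.dvd_rhs {κ : ℝ} {b c : ℝ[X]} (h : IsHirotaPair κ b c) :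
    b ∣ yablonskiiVorobevRHS c := by
  have hcop : IsCoprime b (derivative b ^ 2) :=
    (show IsCoprime b _ from h.separable_left).pow_right
  refine hcop.dvd_of_dvd_mul_left ?_
  have h2 := h.bilinear_two
  have h2' := derivative_bilinear_two h2
  have h3 := h.bilinear_three
  rw [← Ideal.mem_span_singleton, ← Ideal.Quotient.eq_zero_iff_mem]
  have hb : (Ideal.Quotient.mk (Ideal.span {b})) b = 0 :=
    Ideal.Quotient.eq_zero_iff_mem.2 (Ideal.mem_span_singleton_self b)
  replace h2 := congrArg (Ideal.Quotient.mk (Ideal.span {b})) h2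
  replace h2' := congrArg (Ideal.Quotient.mk (Ideal.span {b})) h2'
  replace h3 := congrArg (Ideal.Quotient.mk (Ideal.span {b})) h3
  simp only [map_add, map_sub, map_mul, map_ofNat, map_zero, hb, mul_zero,
    yablonskiiVorobevRHS, map_pow] at h2 h2' h3 ⊢
  generalize (Ideal.Quotient.mk (Ideal.span {b})) (derivative (derivative (derivative c))) = c3 at *
  generalize (Ideal.Quotient.mk (Ideal.span {b})) (derivative (derivative c)) = c2 at *
  generalize (Ideal.Quotient.mk (Ideal.span {b})) (derivative c) = c1 at *
  generalize (Ideal.Quotient.mk (Ideal.span {b})) c = c0 at *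
  generalize (Ideal.Quotient.mk (Ideal.span {b})) (derivative (derivative (derivative b))) = b3 at *
  generalize (Ideal.Quotient.mk (Ideal.span {b})) (derivative (derivative b)) = b2 at *
  generalize (Ideal.Quotient.mk (Ideal.span {b})) (derivative b) = b1 at *
  generalize (Ideal.Quotient.mk (Ideal.span {b})) X = z at *
  have e1 : c2 * b1 = c0 * b3 - c1 * b2 := by linear_combination -h2'
  have e2 : 2 * c1 * b1 = c0 * b2 := by linear_combination -h2
  linear_combination c0 * b1 * h3 - c0 * b1 * e1 + 2 * c1 * b1 * e2

/-- The key identity: the Wronskian of `b` and the next polynomial `d` is a positive multiple of a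
square (for `κ > 0`). -/
theorem IsHirotaPair.wronskian {κ : ℝ} {b c d : ℝ[X]} (h : IsHirotaPair κ b c)
    (hd : d * b = yablonskiiVorobevRHS c) :
    derivative d * b - d * derivative b = C (2 * κ + 1) * c ^ 2 := by
  have h2 := h.bilinear_two
  have h2' := derivative_bilinear_two h2
  have h3 := h.bilinear_three
  unfold yablonskiiVorobevRHS at hd
  have hd' := congrArg derivative hd
  simp only [derivative_sub, derivative_mul, derivative_ofNat, derivative_X,
    derivative_pow] at hd'
  refine mul_left_cancel₀ h.ne_zero_left ?_
  simp only [map_add, map_mul, map_ofNat, map_one, Nat.cast_ofNat, pow_one,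
    Nat.add_one_sub_one] at hd' ⊢
  linear_combination b * hd' - 2 * derivative b * hd - 2 * c * h3 - 2 * c * h2' +
    4 * derivative c * h2

/-- The Bäcklund transformation: the bilinear system passes from `(b, c)` to `(c, d)`. The Wronskian
identity replaces `b d'` and `b d''` by expressions in `b`, `c`, `d` alone, which turns `b` times each
equation for `(c, d)` into a combination of the equations for `(b, c)` and the recursion. -/
theorem IsHirotaPair.step {κ : ℝ} {b c d : ℝ[X]} (h : IsHirotaPair κ b c)
    (hd : d * b = yablonskiiVorobevRHS c) : IsHirotaPair (κ + 1) c d := by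
  have hW := h.wronskian hd
  have h2 := h.bilinear_two
  have h2' := derivative_bilinear_two h2
  have h3 := h.bilinear_three
  -- Modulo `c` the recursion reads `d b ≡ 4 (c')²`, and `c` is separable.
  have hcop : IsCoprime c d := by
    have h4 : IsCoprime c (d * b) := by
      have : d * b = (2 * derivative c) ^ 2 + c * (X * c - 4 * derivative (derivative c)) := by
        rw [hd, yablonskiiVorobevRHS]; ring
      rw [this, IsCoprime.add_mul_left_right_iff]
      have h2u : IsUnit (2 : ℝ[X]) := by
        have := (isUnit_C (R := ℝ) (x := 2)).2 (by simp)
        rwa [map_ofNat] at this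
      exact ((isCoprime_mul_unit_left_right h2u _ _).2 h.separable_right).pow_right
    exact h4.of_mul_right_left
  have hB : derivative (derivative d) * c - 2 * derivative d * derivative c
      + d * derivative (derivative c) = 0 := by
    have hW' := congrArg derivative hW
    simp only [derivative_sub, derivative_mul, derivative_C,
      derivative_pow, Nat.cast_ofNat, pow_one, Nat.add_one_sub_one, map_ofNat] at hW'
    refine mul_left_cancel₀ h.ne_zero_left ?_
    linear_combination c * hW' - 2 * derivative c * hW + d * h2
  have hd0 : d ≠ 0 := by
    rintro rfl
    exact yablonskiiVorobevRHS_ne_zero h.ne_zero_right (by rw [← hd, zero_mul])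
  refine ⟨h.ne_zero_right, hd0, hcop, hB, ?_⟩
  have hB' := derivative_bilinear_two hB
  have hW' := congrArg derivative hW
  simp only [derivative_sub, derivative_mul, derivative_C,
      derivative_pow, Nat.cast_ofNat, pow_one, Nat.add_one_sub_one, map_ofNat] at hW'
  refine mul_left_cancel₀ h.ne_zero_left ?_
  unfold yablonskiiVorobevRHS at hd
  simp only [map_add, map_mul, map_ofNat, map_one] at hW hW' ⊢
  linear_combination b * hB' - 2 * derivative c * hW' +
    (4 * derivative (derivative c) - X * c) * hW - d * h3 - d * h2' + (2 * C κ + 1) * c * hd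

/-! ### The Yablonskii-Vorob'ev polynomials form bilinear pairs -/

theorem isHirotaPair_zero : IsHirotaPair 1 (1 : ℝ[X]) X where
  ne_zero_left := one_ne_zero
  ne_zero_right := X_ne_zero
  isCoprime := isCoprime_one_left
  bilinear_two := by simp
  bilinear_three := by simp

theorem yablonskiiVorobev_mul_of_isHirotaPair {κ : ℝ} {n : ℕ}
    (h : IsHirotaPair κ (yablonskiiVorobev n) (yablonskiiVorobev (n + 1))) :
    yablonskiiVorobev (n + 2) * yablonskiiVorobev n =
      yablonskiiVorobevRHS (yablonskiiVorobev (n + 1)) := by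
  rw [yablonskiiVorobev, mul_comm, EuclideanDomain.mul_div_cancel' h.ne_zero_left h.dvd_rhs]

theorem isHirotaPair_yablonskiiVorobev (n : ℕ) :
    IsHirotaPair ((n : ℝ) + 1) (yablonskiiVorobev n) (yablonskiiVorobev (n + 1)) := by
  induction n with
  | zero => simpa [yablonskiiVorobev] using isHirotaPair_zero
  | succ n ih => simpa using ih.step (yablonskiiVorobev_mul_of_isHirotaPair ih)

/-- The Euclidean division in the definition of `Qₙ₊₂` is exact. -/
theorem yablonskiiVorobev_mul (n : ℕ) :
    yablonskiiVorobev (n + 2) * yablonskiiVorobev n =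
      yablonskiiVorobevRHS (yablonskiiVorobev (n + 1)) :=
  yablonskiiVorobev_mul_of_isHirotaPair (isHirotaPair_yablonskiiVorobev n)

theorem yablonskiiVorobev_ne_zero (n : ℕ) : yablonskiiVorobev n ≠ 0 :=
  (isHirotaPair_yablonskiiVorobev n).ne_zero_left

theorem wronskian_yablonskiiVorobev (n : ℕ) :
    derivative (yablonskiiVorobev (n + 2)) * yablonskiiVorobev n -
      yablonskiiVorobev (n + 2) * derivative (yablonskiiVorobev n) =
    C (2 * (n : ℝ) + 3) * yablonskiiVorobev (n + 1) ^ 2 := by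
  rw [(isHirotaPair_yablonskiiVorobev n).wronskian (yablonskiiVorobev_mul n)]
  congr 2
  ring

/-! ### Rotational symmetry and the value at the origin -/

/-- Over `ℂ`, `f (ω z) = r f (z)`. For `ω` a primitive cube root of unity and `r = ω ^ j`, this says
that only powers of `z` with exponent congruent to `j` modulo `3` occur in `f`. -/
def RotatesBy (ω r : ℂ) (f : ℝ[X]) : Prop :=
  (f.map (algebraMap ℝ ℂ)).comp (C ω * X) = C r * f.map (algebraMap ℝ ℂ)

theorem rotatesBy_derivative {ω r s : ℂ} {f : ℝ[X]} (h : RotatesBy ω r f) (hs : r = ω * s)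
    (hω : ω ≠ 0) : RotatesBy ω s (derivative f) := by
  have h' := congrArg Polynomial.derivative h
  rw [derivative_comp, derivative_C_mul, derivative_C_mul, derivative_X, mul_one, derivative_map,
    hs, C_mul, mul_assoc] at h'
  exact mul_left_cancel₀ (C_ne_zero.2 hω) h'

theorem RotatesBy.rhs {ω r : ℂ} {f : ℝ[X]} (hω : ω ^ 3 = 1) (h : RotatesBy ω r f) :
    RotatesBy ω (ω * r ^ 2) (yablonskiiVorobevRHS f) := by
  have hω0 : ω ≠ 0 := by
    rintro rfl
    norm_num at hω
  have h1 : RotatesBy ω (ω ^ 2 * r) (derivative f) :=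
    rotatesBy_derivative h (by linear_combination -r * hω) hω0
  have h2 : RotatesBy ω (ω * r) (derivative (derivative f)) :=
    rotatesBy_derivative h1 (by ring) hω0
  unfold RotatesBy at *
  have hC : (C ω : ℂ[X]) ^ 3 = 1 := by rw [← C_pow, hω, C_1]
  simp only [yablonskiiVorobevRHS, Polynomial.map_sub, Polynomial.map_mul, Polynomial.map_pow,
    map_X, Polynomial.map_ofNat, sub_comp, mul_comp, pow_comp, X_comp, ofNat_comp, h, h1, h2,
    map_mul, map_pow]
  linear_combination 4 * C ω * C r ^ 2 * (map (algebraMap ℝ ℂ) (derivative f)) ^ 2 * hC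

theorem RotatesBy.of_mul {ω r s t : ℂ} {f g : ℝ[X]} (hg : g ≠ 0) (hs : s ≠ 0)
    (hfg : RotatesBy ω t (f * g)) (h : RotatesBy ω s g) (ht : t = r * s) : RotatesBy ω r f := by
  unfold RotatesBy at *
  rw [Polynomial.map_mul, mul_comp, h, ht, C_mul] at hfg
  refine mul_right_cancel₀ (mul_ne_zero (C_ne_zero.2 hs)
    ((Polynomial.map_ne_zero_iff (algebraMap ℝ ℂ).injective).2 hg)) ?_
  rw [hfg]
  ring

theorem RotatesBy.eval_zero {ω r : ℂ} {f : ℝ[X]} (h : RotatesBy ω r f) (hr : r ≠ 1) :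
    f.eval 0 = 0 := by
  have h' := congrArg (eval 0) h
  simp only [eval_comp, eval_mul, eval_C, eval_X, mul_zero] at h'
  have h0 : eval 0 (f.map (algebraMap ℝ ℂ)) = 0 := by
    have : (r - 1) * eval 0 (f.map (algebraMap ℝ ℂ)) = 0 := by linear_combination -h'
    exact (mul_eq_zero.1 this).resolve_left (sub_ne_zero.2 hr)
  rw [← map_zero (algebraMap ℝ ℂ), eval_map_algebraMap, aeval_algebraMap_apply] at h0
  simpa using h0

/-- The pattern of weights of `Qₙ` is `1, ω, 1` with period three: the weight of `Qₙ₊₂` is `ω` times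
the square of that of `Qₙ₊₁`, divided by that of `Qₙ`. -/
theorem rotatesBy_yablonskiiVorobev {ω : ℂ} (hω : ω ^ 3 = 1) (k : ℕ) :
    RotatesBy ω 1 (yablonskiiVorobev (3 * k)) ∧ RotatesBy ω ω (yablonskiiVorobev (3 * k + 1)) := by
  have hω0 : ω ≠ 0 := by
    rintro rfl
    norm_num at hω
  have step : ∀ {n : ℕ} {r s t : ℂ}, RotatesBy ω r (yablonskiiVorobev n) →
      RotatesBy ω s (yablonskiiVorobev (n + 1)) → r ≠ 0 → ω * s ^ 2 = t * r →
      RotatesBy ω t (yablonskiiVorobev (n + 2)) := by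
    intro n r s t hr hs hr0 ht
    refine RotatesBy.of_mul (yablonskiiVorobev_ne_zero n) hr0 ?_ hr ht
    rw [yablonskiiVorobev_mul]
    exact hs.rhs hω
  induction k with
  | zero => constructor <;> simp [RotatesBy, yablonskiiVorobev]
  | succ k ih =>
    obtain ⟨h0, h1⟩ := ih
    have h2 := step (t := 1) h0 h1 one_ne_zero (by linear_combination hω)
    have h3 := step (t := 1) h1 h2 hω0 (by ring)
    have h4 := step (t := ω) h2 h3 one_ne_zero (by ring)
    exact ⟨h3, h4⟩

theorem eval_zero_yablonskiiVorobev (k : ℕ) : (yablonskiiVorobev (3 * k + 1)).eval 0 = 0 := by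
  have h := Complex.isPrimitiveRoot_exp 3 (by norm_num)
  exact (rotatesBy_yablonskiiVorobev h.pow_eq_one k).2.eval_zero (h.ne_one (by norm_num))

theorem eval_ne_zero_of_isCoprime {f g : ℝ[X]} (h : IsCoprime f g) {x : ℝ} (hf : f.eval x = 0) :
    g.eval x ≠ 0 := by
  obtain ⟨a, b, hab⟩ := h
  intro hg
  simpa [hf, hg] using congrArg (eval x) hab

open Classical in
/-- The finite set of real roots of `f` in `s`, without multiplicity; it is empty for `f = 0`. -/
noncomputable def rootsIn (f : ℝ[X]) (s : Set ℝ) : Finset ℝ :=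
  f.roots.toFinset.filter (· ∈ s)

theorem mem_rootsIn {f : ℝ[X]} (hf : f ≠ 0) {s : Set ℝ} {x : ℝ} :
    x ∈ rootsIn f s ↔ f.eval x = 0 ∧ x ∈ s := by
  simp [rootsIn, hf]

/-! ### Interlacing of real roots -/

/-- The polynomials `p` and `q` have no common root and `q' p - q p' ≥ 0` on the real line. Away from
the roots of `p` the quotient `q / p` is then increasing, and away from those of `q` the quotient
`p / q` is decreasing. -/
structure PosWronskian (p q : ℝ[X]) : Prop where
  ne_zero_left : p ≠ 0
  ne_zero_right : q ≠ 0
  eval_ne_zero : ∀ x, p.eval x = 0 → q.eval x ≠ 0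
  nonneg : ∀ x, 0 ≤ (derivative q * p - q * derivative p).eval x

theorem PosWronskian.swap {p q : ℝ[X]} (h : PosWronskian p q) : PosWronskian q (-p) where
  ne_zero_left := h.ne_zero_right
  ne_zero_right := neg_ne_zero.2 h.ne_zero_left
  eval_ne_zero x hq hp := h.eval_ne_zero x (by simpa using hp) hq
  nonneg x := by
    have := h.nonneg x
    simp only [eval_sub, eval_mul, derivative_neg, eval_neg] at this ⊢
    linarith

/-- The sign conditions say that `p / q` is nonpositive at `x` and nonnegative at `y`; as `p / q` is
decreasing where `q` does not vanish, there is a root of `q` in between. The hypotheses at both ends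
hold in particular at every root of `p`. -/
theorem PosWronskian.exists_root {p q : ℝ[X]} (h : PosWronskian p q) {x y : ℝ} (hxy : x < y)
    (hx : p.eval x * q.eval x ≤ 0) (hqx : q.eval x ≠ 0)
    (hy : 0 ≤ p.eval y * q.eval y) (hqy : q.eval y ≠ 0) :
    ∃ z, q.eval z = 0 ∧ x < z ∧ z < y := by
  by_contra! hno
  have hq : ∀ z ∈ Set.Icc x y, q.eval z ≠ 0 := by
    rintro z ⟨hz1, hz2⟩ hz
    rcases hz1.eq_or_lt with rfl | hz1
    · exact hqx hz
    rcases hz2.eq_or_lt with rfl | hz2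
    · exact hqy hz
    · exact absurd hz2 (not_lt.2 (hno z hz hz1))
  let g : ℝ → ℝ := fun z => p.eval z / q.eval z
  have hg : ∀ z ∈ Set.Icc x y, HasDerivAt g
      (-(derivative q * p - q * derivative p).eval z / q.eval z ^ 2) z := by
    intro z hz
    refine ((p.hasDerivAt z).fun_div (q.hasDerivAt z) (hq z hz)).congr_deriv ?_
    simp only [eval_sub, eval_mul]
    ring
  have hanti : AntitoneOn g (Set.Icc x y) := by
    refine antitoneOn_of_deriv_nonpos (convex_Icc x y)
      (fun z hz => (hg z hz).continuousAt.continuousWithinAt) (fun z hz => ?_) (fun z hz => ?_)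
    · exact (hg z (interior_subset hz)).differentiableAt.differentiableWithinAt
    · rw [(hg z (interior_subset hz)).deriv]
      exact div_nonpos_of_nonpos_of_nonneg (neg_nonpos.2 (h.nonneg z)) (sq_nonneg _)
  have hgx : g x ≤ 0 := by
    have : g x = p.eval x * q.eval x / q.eval x ^ 2 := by
      simp only [g]; field_simp
    rw [this]
    exact div_nonpos_of_nonpos_of_nonneg hx (sq_nonneg _)
  have hgy : 0 ≤ g y := by
    have : g y = p.eval y * q.eval y / q.eval y ^ 2 := by
      simp only [g]; field_simp
    rw [this]
    exact div_nonneg hy (sq_nonneg _)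
  -- Monotone with these end values, `p / q` vanishes on `[x, y]`, which forces `p = 0`.
  have hg0 : ∀ z ∈ Set.Icc x y, g z = 0 := fun z hz =>
    le_antisymm ((hanti (Set.left_mem_Icc.2 hxy.le) hz hz.1).trans hgx)
      (hgy.trans (hanti hz (Set.right_mem_Icc.2 hxy.le) hz.2))
  refine h.ne_zero_left (p.eq_zero_of_infinite_isRoot ((Set.Icc_infinite hxy).mono fun z hz => ?_))
  exact (div_eq_zero_iff.1 (hg0 z hz)).resolve_right (hq z hz)

/-- If `s` is a finite subset of `[L, R]` consisting of points between any two of which `q` has a root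
by `PosWronskian.exists_root`, such as roots of `p` or suitable endpoints, then `s` has at most one
more element than there are roots of `q` in `(L, R)`. -/
theorem PosWronskian.card_le {p q : ℝ[X]} (h : PosWronskian p q) {L R : ℝ} {s : Finset ℝ}
    (hs : ∀ x ∈ s, L ≤ x ∧ x ≤ R)
    (hleft : ∀ x ∈ s, x ≠ R → p.eval x * q.eval x ≤ 0 ∧ q.eval x ≠ 0)
    (hright : ∀ x ∈ s, x ≠ L → 0 ≤ p.eval x * q.eval x ∧ q.eval x ≠ 0) :
    s.card ≤ (rootsIn q (Set.Ioo L R)).card + 1 := by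
  refine Finset.card_le_of_interleaved fun x hx y hy hxy _ => ?_
  obtain ⟨h1, h2⟩ := hleft x hx (hxy.trans_le (hs y hy).2).ne
  obtain ⟨h3, h4⟩ := hright y hy ((hs x hx).1.trans_lt hxy).ne'
  obtain ⟨z, hz, hxz, hzy⟩ := h.exists_root hxy h1 h2 h3 h4
  exact ⟨z, (mem_rootsIn h.ne_zero_right).2
    ⟨hz, (hs x hx).1.trans_lt hxz, hzy.trans_le (hs y hy).2⟩, hxz, hzy⟩

theorem PosWronskian.card_le_left {p q : ℝ[X]} (h : PosWronskian p q) {L R : ℝ} {s : Finset ℝ}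
    (hs : ∀ x ∈ s, L ≤ x ∧ x ≤ R)
    (hleft : ∀ x ∈ s, x ≠ R → 0 ≤ p.eval x * q.eval x ∧ p.eval x ≠ 0)
    (hright : ∀ x ∈ s, x ≠ L → p.eval x * q.eval x ≤ 0 ∧ p.eval x ≠ 0) :
    s.card ≤ (rootsIn p (Set.Ioo L R)).card + 1 := by
  have := h.swap.card_le hs (by simpa [mul_comm] using hleft) (by simpa [mul_comm] using hright)
  simpa [rootsIn] using this

theorem PosWronskian.sign_of_root_left {p q : ℝ[X]} (h : PosWronskian p q) {s : Set ℝ} {x : ℝ}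
    (hx : x ∈ rootsIn p s) : p.eval x * q.eval x = 0 ∧ q.eval x ≠ 0 ∧ x ∈ s := by
  obtain ⟨h0, hs⟩ := (mem_rootsIn h.ne_zero_left).1 hx
  exact ⟨by rw [h0, zero_mul], h.eval_ne_zero x h0, hs⟩

theorem PosWronskian.sign_of_root_right {p q : ℝ[X]} (h : PosWronskian p q) {s : Set ℝ} {x : ℝ}
    (hx : x ∈ rootsIn q s) : p.eval x * q.eval x = 0 ∧ p.eval x ≠ 0 ∧ x ∈ s := by
  obtain ⟨h0, hs⟩ := (mem_rootsIn h.ne_zero_right).1 hx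
  exact ⟨by rw [h0, mul_zero], fun hp => h.eval_ne_zero x hp h0, hs⟩

/-- If `q / p` starts at `L` from values in `[-∞, 0)` and ends at `R` with values in `(0, ∞]`, then `q`
has one root more than `p` in between. -/
theorem PosWronskian.card_eq_add_one {p q : ℝ[X]} (h : PosWronskian p q) {L R : ℝ} (hLR : L < R)
    (hL : p.eval L * q.eval L ≤ 0) (hL' : q.eval L ≠ 0)
    (hR : 0 ≤ p.eval R * q.eval R) (hR' : q.eval R ≠ 0) :
    (rootsIn q (Set.Ioo L R)).card = (rootsIn p (Set.Ioo L R)).card + 1 := by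
  classical
  refine le_antisymm (h.card_le_left ?_ ?_ ?_) ?_
  · exact fun x hx => ⟨(h.sign_of_root_right hx).2.2.1.le, (h.sign_of_root_right hx).2.2.2.le⟩
  · exact fun x hx _ => ⟨(h.sign_of_root_right hx).1.ge, (h.sign_of_root_right hx).2.1⟩
  · exact fun x hx _ => ⟨(h.sign_of_root_right hx).1.le, (h.sign_of_root_right hx).2.1⟩
  · have hRn : R ∉ rootsIn p (Set.Ioo L R) := fun hx =>
      lt_irrefl R (h.sign_of_root_left hx).2.2.2
    have hLn : L ∉ insert R (rootsIn p (Set.Ioo L R)) := by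
      rw [Finset.mem_insert, not_or]
      exact ⟨hLR.ne, fun hx => lt_irrefl L (h.sign_of_root_left hx).2.2.1⟩
    have := h.card_le (L := L) (R := R) (s := insert L (insert R (rootsIn p (Set.Ioo L R)))) ?_ ?_ ?_
    · rw [Finset.card_insert_of_notMem hLn, Finset.card_insert_of_notMem hRn] at this
      omega
    all_goals
      intro x hx
      rw [Finset.mem_insert, Finset.mem_insert] at hx
      rcases hx with rfl | rfl | hx
    · exact ⟨le_rfl, hLR.le⟩
    · exact ⟨hLR.le, le_rfl⟩
    · exact ⟨(h.sign_of_root_left hx).2.2.1.le, (h.sign_of_root_left hx).2.2.2.le⟩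
    · exact fun _ => ⟨hL, hL'⟩
    · exact fun hx => absurd rfl hx
    · exact fun _ => ⟨(h.sign_of_root_left hx).1.le, (h.sign_of_root_left hx).2.1⟩
    · exact fun hx => absurd rfl hx
    · exact fun _ => ⟨hR, hR'⟩
    · exact fun _ => ⟨(h.sign_of_root_left hx).1.ge, (h.sign_of_root_left hx).2.1⟩

/-- If `q / p` starts at `L` from values in `[-∞, 0)` and ends at `R` with values in `(-∞, 0]`, then `q`
has as many roots as `p` in between. -/
theorem PosWronskian.card_eq_of_right {p q : ℝ[X]} (h : PosWronskian p q) {L R : ℝ} (hLR : L < R)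
    (hL : p.eval L * q.eval L ≤ 0) (hL' : q.eval L ≠ 0)
    (hR : p.eval R * q.eval R ≤ 0) (hR' : p.eval R ≠ 0) :
    (rootsIn q (Set.Ioo L R)).card = (rootsIn p (Set.Ioo L R)).card := by
  classical
  have hRn : R ∉ rootsIn q (Set.Ioo L R) := fun hx =>
    lt_irrefl R (h.sign_of_root_right hx).2.2.2
  have hLn : L ∉ rootsIn p (Set.Ioo L R) := fun hx =>
    lt_irrefl L (h.sign_of_root_left hx).2.2.1
  have h1 := h.card_le (L := L) (R := R) (s := insert L (rootsIn p (Set.Ioo L R))) ?_ ?_ ?_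
  have h2 := h.card_le_left (L := L) (R := R) (s := insert R (rootsIn q (Set.Ioo L R))) ?_ ?_ ?_
  · rw [Finset.card_insert_of_notMem hLn] at h1
    rw [Finset.card_insert_of_notMem hRn] at h2
    omega
  all_goals
    intro x hx
    rw [Finset.mem_insert] at hx
    rcases hx with rfl | hx
  · exact ⟨hLR.le, le_rfl⟩
  · exact ⟨(h.sign_of_root_right hx).2.2.1.le, (h.sign_of_root_right hx).2.2.2.le⟩
  · exact fun hx => absurd rfl hx
  · exact fun _ => ⟨(h.sign_of_root_right hx).1.ge, (h.sign_of_root_right hx).2.1⟩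
  · exact fun _ => ⟨hR, hR'⟩
  · exact fun _ => ⟨(h.sign_of_root_right hx).1.le, (h.sign_of_root_right hx).2.1⟩
  · exact ⟨le_rfl, hLR.le⟩
  · exact ⟨(h.sign_of_root_left hx).2.2.1.le, (h.sign_of_root_left hx).2.2.2.le⟩
  · exact fun _ => ⟨hL, hL'⟩
  · exact fun _ => ⟨(h.sign_of_root_left hx).1.le, (h.sign_of_root_left hx).2.1⟩
  · exact fun hx => absurd rfl hx
  · exact fun _ => ⟨(h.sign_of_root_left hx).1.ge, (h.sign_of_root_left hx).2.1⟩

/-- If `q / p` starts at `L` from values in `[0, ∞)` and ends at `R` with values in `(0, ∞]`, then `q`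
has as many roots as `p` in between. -/
theorem PosWronskian.card_eq_of_left {p q : ℝ[X]} (h : PosWronskian p q) {L R : ℝ} (hLR : L < R)
    (hL : 0 ≤ p.eval L * q.eval L) (hL' : p.eval L ≠ 0)
    (hR : 0 ≤ p.eval R * q.eval R) (hR' : q.eval R ≠ 0) :
    (rootsIn q (Set.Ioo L R)).card = (rootsIn p (Set.Ioo L R)).card := by
  have h' := h.swap.card_eq_of_right hLR (by simpa [mul_comm] using hL) (by simpa using hL')
    (by simpa [mul_comm] using hR) hR'
  simpa [rootsIn] using h'.symm

/-! ### Comparing root counts on the two half-lines -/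

theorem exists_bound_of_odd {f : ℝ[X]} (hdeg : Odd f.natDegree) (hlc : 0 < f.leadingCoeff) :
    ∃ M : ℝ, 0 < M ∧ (∀ x, M ≤ x → 0 < f.eval x) ∧ ∀ x, x ≤ -M → f.eval x < 0 := by
  have key : ∀ g : ℝ[X], Odd g.natDegree → 0 < g.leadingCoeff →
      ∃ M : ℝ, ∀ x, M ≤ x → 0 < g.eval x := by
    intro g hg hlc
    have hdeg : 0 < g.degree := natDegree_pos_iff_degree_pos.1 hg.pos
    exact Filter.eventually_atTop.1
      ((g.tendsto_atTop_of_leadingCoeff_nonneg hdeg hlc.le).eventually_gt_atTop 0)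
  obtain ⟨M₁, h₁⟩ := key f hdeg hlc
  obtain ⟨M₂, h₂⟩ := key (-f.comp (-X)) (by simpa [natDegree_comp] using hdeg)
    (by rw [leadingCoeff_neg, comp_neg_X_leadingCoeff_eq, hdeg.neg_one_pow]; linarith)
  refine ⟨max 1 (max M₁ M₂), by positivity, fun x hx => h₁ x ?_, fun x hx => ?_⟩
  · exact (le_max_left _ _).trans ((le_max_right _ _).trans hx)
  · have := h₂ (-x) (by linarith [(le_max_right M₁ M₂).trans (le_max_right 1 _)])
    simpa using this

theorem rootsIn_congr {f : ℝ[X]} (hf : f ≠ 0) {s t : Set ℝ}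
    (h : ∀ x, f.eval x = 0 → (x ∈ s ↔ x ∈ t)) : rootsIn f s = rootsIn f t := by
  ext x
  rw [mem_rootsIn hf, mem_rootsIn hf]
  exact and_congr_right (h x)

/-- Far to the left `q / p` is negative, far to the right it is positive, and all roots lie in
between. -/
theorem PosWronskian.exists_bound {p q : ℝ[X]} (h : PosWronskian p q)
    (hdeg : Odd (q * p).natDegree) (hlc : 0 < (q * p).leadingCoeff) :
    ∃ M : ℝ, 0 < M ∧ 0 < p.eval M * q.eval M ∧ p.eval (-M) * q.eval (-M) < 0 ∧
      rootsIn p (Set.Iio 0) = rootsIn p (Set.Ioo (-M) 0) ∧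
      rootsIn q (Set.Iio 0) = rootsIn q (Set.Ioo (-M) 0) ∧
      rootsIn p (Set.Ioi 0) = rootsIn p (Set.Ioo 0 M) ∧
      rootsIn q (Set.Ioi 0) = rootsIn q (Set.Ioo 0 M) := by
  obtain ⟨M, hM, hpos, hneg⟩ := exists_bound_of_odd hdeg hlc
  have hin : ∀ x, (q * p).eval x = 0 → -M < x ∧ x < M := fun x hx =>
    ⟨lt_of_not_ge fun hx' => (hneg x hx').ne hx, lt_of_not_ge fun hx' => (hpos x hx').ne' hx⟩
  have hp : ∀ x, p.eval x = 0 → -M < x ∧ x < M := fun x hx => hin x (by simp [hx])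
  have hq : ∀ x, q.eval x = 0 → -M < x ∧ x < M := fun x hx => hin x (by simp [hx])
  refine ⟨M, hM, by simpa [mul_comm] using hpos M le_rfl, by simpa [mul_comm] using hneg (-M) le_rfl,
    rootsIn_congr h.ne_zero_left fun x hx => ?_, rootsIn_congr h.ne_zero_right fun x hx => ?_,
    rootsIn_congr h.ne_zero_left fun x hx => ?_, rootsIn_congr h.ne_zero_right fun x hx => ?_⟩
  · simp [(hp x hx).1]
  · simp [(hq x hx).1]
  · simp [(hp x hx).2]
  · simp [(hq x hx).2]

theorem PosWronskian.card_neg_pos {p q : ℝ[X]} (h : PosWronskian p q)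
    (hdeg : Odd (q * p).natDegree) (hlc : 0 < (q * p).leadingCoeff) :
    (q.eval 0 = 0 → (rootsIn q (Set.Iio 0)).card = (rootsIn p (Set.Iio 0)).card) ∧
    (q.eval 0 ≠ 0 → 0 ≤ p.eval 0 * q.eval 0 →
      (rootsIn q (Set.Iio 0)).card = (rootsIn p (Set.Iio 0)).card + 1) ∧
    (p.eval 0 = 0 → (rootsIn q (Set.Ioi 0)).card = (rootsIn p (Set.Ioi 0)).card + 1) ∧
    (p.eval 0 ≠ 0 → 0 ≤ p.eval 0 * q.eval 0 →
      (rootsIn q (Set.Ioi 0)).card = (rootsIn p (Set.Ioi 0)).card) := by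
  obtain ⟨M, hM, hpos, hneg, h1, h2, h3, h4⟩ := h.exists_bound hdeg hlc
  rw [h1, h2, h3, h4]
  have hqM := (mul_ne_zero_iff.1 hpos.ne').2
  have hqM' := (mul_ne_zero_iff.1 hneg.ne).2
  have hM' : -M < 0 := neg_lt_zero.2 hM
  refine ⟨fun h0 => ?_, fun h0 h0' => ?_, fun h0 => ?_, fun h0 h0' => ?_⟩
  · exact h.card_eq_of_right hM' hneg.le hqM' (by simp [h0]) fun hp => h.eval_ne_zero 0 hp h0
  · exact h.card_eq_add_one hM' hneg.le hqM' h0' h0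
  · exact h.card_eq_add_one hM (by simp [h0]) (h.eval_ne_zero 0 h0) hpos.le hqM
  · exact h.card_eq_of_left hM h0' h0 hpos.le hqM

/-! ### Counting the roots of the Yablonskii-Vorob'ev polynomials -/

theorem posWronskian_yablonskiiVorobev (n : ℕ) :
    PosWronskian (yablonskiiVorobev n) (yablonskiiVorobev (n + 2)) where
  ne_zero_left := yablonskiiVorobev_ne_zero n
  ne_zero_right := yablonskiiVorobev_ne_zero (n + 2)
  eval_ne_zero x hp hq := by
    have hW := congrArg (eval x) (wronskian_yablonskiiVorobev n)
    simp only [eval_sub, eval_mul, hp, hq, mul_zero, zero_mul, sub_zero, eval_C, eval_pow] at hW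
    have h0 : (2 * (n : ℝ) + 3) ≠ 0 := by positivity
    exact eval_ne_zero_of_isCoprime (isHirotaPair_yablonskiiVorobev n).isCoprime hp
      (pow_eq_zero_iff two_ne_zero |>.1 ((mul_eq_zero.1 hW.symm).resolve_left h0))
  nonneg x := by
    rw [wronskian_yablonskiiVorobev, eval_mul, eval_C, eval_pow]
    positivity

/-- The increment of the root counts from `Qₙ` to `Qₙ₊₂` is governed by `Qₙ₊₂ / Qₙ` at the origin:
positive for `n ≡ 0`, infinite for `n ≡ 1`, zero for `n ≡ 2` modulo `3`. -/
theorem card_step (n : ℕ) :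
    (rootsIn (yablonskiiVorobev (n + 2)) (Set.Iio 0)).card =
      (rootsIn (yablonskiiVorobev n) (Set.Iio 0)).card + (if n % 3 = 2 then 0 else 1) ∧
    (rootsIn (yablonskiiVorobev (n + 2)) (Set.Ioi 0)).card =
      (rootsIn (yablonskiiVorobev n) (Set.Ioi 0)).card + (if n % 3 = 1 then 1 else 0) := by
  have hc := yablonskiiVorobev_ne_zero (n + 1)
  have hW := posWronskian_yablonskiiVorobev n
  obtain ⟨hn, hn', hp, hp'⟩ := hW.card_neg_pos
    (by rw [yablonskiiVorobev_mul, (leading_yablonskiiVorobevRHS hc).1]; exact odd_two_mul_add_one _)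
    (by rw [yablonskiiVorobev_mul, (leading_yablonskiiVorobevRHS hc).2]
        exact sq_pos_of_ne_zero (leadingCoeff_ne_zero.2 hc))
  obtain ⟨k, rfl | rfl | rfl⟩ : ∃ k, n = 3 * k ∨ n = 3 * k + 1 ∨ n = 3 * k + 2 :=
    ⟨n / 3, by omega⟩
  · have h1 := eval_zero_yablonskiiVorobev k
    have hsep := (isHirotaPair_yablonskiiVorobev (3 * k)).separable_right
    have h1' := eval_ne_zero_of_isCoprime hsep h1
    -- The recursion at `0`, where `Q_{3k+1}` has a simple root, reduces to
    -- `Q_{3k+2}(0) Q_{3k}(0) = 4 Q_{3k+1}'(0)²`.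
    have h2 : 0 < (yablonskiiVorobev (3 * k)).eval 0 * (yablonskiiVorobev (3 * k + 2)).eval 0 := by
      have := congrArg (eval 0) (yablonskiiVorobev_mul (3 * k))
      simp only [yablonskiiVorobevRHS, eval_mul, eval_sub, eval_X, eval_pow, h1, eval_ofNat] at this
      have h3 : 0 < eval 0 (derivative (yablonskiiVorobev (3 * k + 1))) ^ 2 := by positivity
      linarith
    obtain ⟨hp0, hq0⟩ := mul_ne_zero_iff.1 h2.ne'
    rw [hn' hq0 h2.le, hp' hp0 h2.le, if_neg (by omega), if_neg (by omega)]
    exact ⟨rfl, rfl⟩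
  · have h1 := eval_zero_yablonskiiVorobev k
    rw [hn' (hW.eval_ne_zero 0 h1) (by rw [h1, zero_mul]), hp h1, if_neg (by omega),
      if_pos (by omega)]
    exact ⟨rfl, rfl⟩
  · have h1 : (yablonskiiVorobev (3 * k + 2 + 2)).eval 0 = 0 := eval_zero_yablonskiiVorobev (k + 1)
    rw [hn h1, hp' (fun h0 => hW.eval_ne_zero 0 h0 h1) (by rw [h1, mul_zero]), if_pos (by omega),
      if_neg (by omega)]
    exact ⟨rfl, rfl⟩

theorem card_rootsIn_yablonskiiVorobev (n : ℕ) :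
    (rootsIn (yablonskiiVorobev n) (Set.Iio 0)).card = (n + 1) / 3 ∧
    (rootsIn (yablonskiiVorobev n) (Set.Ioi 0)).card = if Even n then n / 6 else (n + 3) / 6 := by
  induction n using Nat.twoStepInduction with
  | zero => simp [rootsIn, yablonskiiVorobev]
  | one => simp [rootsIn, yablonskiiVorobev, Finset.filter_singleton]
  | more n ih _ =>
    obtain ⟨h1, h2⟩ := card_step n
    rw [h1, h2, ih.1, ih.2]
    simp only [Nat.even_iff]
    constructor <;> split_ifs <;> omega

theorem encard_realRoots_inter (n : ℕ) (s : Set ℝ) :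
    (yablonskiiVorobevRealRoots n ∩ s).encard = (rootsIn (yablonskiiVorobev n) s).card := by
  rw [← Set.encard_coe_eq_coe_finsetCard]
  congr 1
  ext x
  rw [Finset.mem_coe, mem_rootsIn (yablonskiiVorobev_ne_zero n)]
  rfl

theorem theorem3 :
    (∀ n : ℕ, yablonskiiVorobev (n + 2) * yablonskiiVorobev n =
        X * yablonskiiVorobev (n + 1) ^ 2 -
          4 * (yablonskiiVorobev (n + 1) * derivative (derivative (yablonskiiVorobev (n + 1))) -
            derivative (yablonskiiVorobev (n + 1)) ^ 2)) ∧
    ∀ n : ℕ,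
      (yablonskiiVorobevRealRoots n ∩ Set.Iio 0).encard = ((n + 1) / 3 : ℕ) ∧
      (yablonskiiVorobevRealRoots n ∩ Set.Ioi 0).encard =
        ((if Even n then n / 6 else (n + 3) / 6 : ℕ) : ℕ∞) := by
  refine ⟨yablonskiiVorobev_mul, fun n => ?_⟩
  rw [encard_realRoots_inter, encard_realRoots_inter]
  exact ⟨congrArg _ (card_rootsIn_yablonskiiVorobev n).1,
    congrArg _ (card_rootsIn_yablonskiiVorobev n).2⟩
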